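/- Let $n\ge 3$ and let $(M^n,g)$ be a connected smooth Riemannian manifold whose metric has the form $$g=dt^2+\sum_{i=1}^{n-1}h_i(t)^2\,dx_i^2 ,$$ i.e. $t:M\to\mathbb R$ is a function with range $I$ (an open interval), $h_1,\dots,h_{n-1}$ are smooth functions on $I$, and every point of $M$ has a neighbourhood with smooth coordinates $(t,x_1,\dots,x_{n-1})$ in which $g$ is given by this formula (so the level sets of $t$ are locally Euclidean). Assume that not all $h_i$ are constant. Let $f=f(t)$, with $f:I\to\mathbb R$ smooth, be such that $(M,g,f)$ is a steady gradient Ricci soliton, that is, $\mathrm{Ric}+\mathrm{Hess}\,f=0$. Then: 1. The metric $g$ is incomplete. 2. With $u_0=f'$ and $u_i=h_i'/h_i$, $A=\sum_i u_i$, $B=\sum_i u_i^2$, the soliton equation gives, on $I$, the system $$u_j'=(u_0-A)\,u_j\quad(1\le j\le n-1),\qquad u_0'=B+(u_0-A)A .$$ 3. The solution $(u_0,\dots,u_{n-1})$ blows up in finite time: it extends to a solution of this system on an open interval $J\supseteq I$ that has a finite endpoint $T$ such that $B\to\infty$ and $|u_0-A|\to\infty$ as $t\to T$ in $J$. If moreover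 $A^2\ne B$ at some point of $J$, then also $|u_0|\to\infty$ as $t\to T$ in $J$. -/

import Mathlib

open scoped Manifold ContDiff Topology Bundle
open Set Filter Bundle

noncomputable section

/-- Partial derivative `∂ᵢ F` of a real function on `ℝᵈ`. -/
def partialD {d : ℕ} (i : Fin d) (F : EuclideanSpace ℝ (Fin d) → ℝ)
    (y : EuclideanSpace ℝ (Fin d)) : ℝ :=
  fderiv ℝ F y (EuclideanSpace.single i 1)

/-- Christoffel symbol `Γᵏᵢⱼ = ½ ∑ₗ gᵏˡ (∂ᵢ gⱼₗ + ∂ⱼ gᵢₗ - ∂ₗ gᵢⱼ)` of the metric with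
coefficient matrix `G`. -/
def christoffel {d : ℕ} (G : EuclideanSpace ℝ (Fin d) → Matrix (Fin d) (Fin d) ℝ)
    (k i j : Fin d) (y : EuclideanSpace ℝ (Fin d)) : ℝ :=
  (1 / 2 : ℝ) * ∑ l, (G y)⁻¹ k l *
    (partialD i (fun z => G z j l) y + partialD j (fun z => G z i l) y
      - partialD l (fun z => G z i j) y)

/-- Ricci tensor in coordinates:
`Ricᵢⱼ = ∑ₖ (∂ₖ Γᵏᵢⱼ - ∂ⱼ Γᵏᵢₖ) + ∑ₖ ∑ₗ (Γᵏₖₗ Γˡᵢⱼ - Γᵏⱼₗ Γˡᵢₖ)`.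
With this sign round spheres have positive Ricci curvature. -/
def ricciCoord {d : ℕ} (G : EuclideanSpace ℝ (Fin d) → Matrix (Fin d) (Fin d) ℝ)
    (i j : Fin d) (y : EuclideanSpace ℝ (Fin d)) : ℝ :=
  ∑ k, (partialD k (christoffel G k i j) y - partialD j (christoffel G k i k) y
    + ∑ l, (christoffel G k k l y * christoffel G l i j y
      - christoffel G k j l y * christoffel G l i k y))

/-- Hessian in coordinates: `(Hess F)ᵢⱼ = ∂ᵢ ∂ⱼ F - ∑ₖ Γᵏᵢⱼ ∂ₖ F`. -/
def hessCoord {d : ℕ} (G : EuclideanSpace ℝ (Fin d) → Matrix (Fin d) (Fin d) ℝ)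
    (F : EuclideanSpace ℝ (Fin d) → ℝ) (i j : Fin d) (y : EuclideanSpace ℝ (Fin d)) : ℝ :=
  partialD i (partialD j F) y - ∑ k, christoffel G k i j y * partialD k F y

section Manifold

variable {d : ℕ} {M : Type*} [TopologicalSpace M] [ChartedSpace (EuclideanSpace ℝ (Fin d)) M]
  [RiemannianBundle (fun x : M => TangentSpace (𝓡 d) x)]

/-- The matrix `gᵢⱼ = g(∂ᵢ, ∂ⱼ)` of the Riemannian metric of `M` in the chart `φ`, as a function
on the target of `φ`; the coordinate field `∂ᵢ` is the image of the `i`-th basis vector under the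
differential of `φ⁻¹`. -/
def metricCoeff (φ : OpenPartialHomeomorph M (EuclideanSpace ℝ (Fin d)))
    (y : EuclideanSpace ℝ (Fin d)) : Matrix (Fin d) (Fin d) ℝ :=
  Matrix.of fun i j =>
    inner ℝ
      (mfderiv (𝓡 d) (𝓡 d) φ.symm y
        (EuclideanSpace.single i 1 : EuclideanSpace ℝ (Fin d)))
      (mfderiv (𝓡 d) (𝓡 d) φ.symm y
        (EuclideanSpace.single j 1 : EuclideanSpace ℝ (Fin d)))

/-- `(M, g, f)` is a gradient Ricci soliton with constant `c`: `f` is smooth and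
`Ric + Hess f = c g` in every smooth chart.  It is steady when `c = 0`. -/
def IsGradientRicciSoliton (c : ℝ) (f : M → ℝ) : Prop :=
  ContMDiff (𝓡 d) 𝓘(ℝ, ℝ) ∞ f ∧
  ∀ φ ∈ IsManifold.maximalAtlas (𝓡 d) ∞ M, ∀ y ∈ φ.target, ∀ i j : Fin d,
    ricciCoord (metricCoeff φ) i j y + hessCoord (metricCoeff φ) (f ∘ φ.symm) i j y
      = c * metricCoeff φ y i j

end Manifold

/-- The metric of the `(n+1)`-dimensional manifold `M` has the form `dt² + ∑ᵢ hᵢ(t)² dxᵢ²`, where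
`t` is a function on `M`, the `hᵢ` are smooth functions on its range, and `x₁, …, xₙ` are local
coordinates: around every point there is a smooth chart with coordinates `(t, x₁, …, xₙ)` in which
the matrix of the metric is diagonal with entries `1, h₁(t)², …, hₙ(t)²`.  (Since the metric is
positive definite, no `hᵢ` vanishes on the range of `t`.) -/
structure HasEuclideanLevels {n : ℕ} {M : Type*} [TopologicalSpace M]
    [ChartedSpace (EuclideanSpace ℝ (Fin (n + 1))) M]
    [RiemannianBundle (fun x : M => TangentSpace (𝓡 (n + 1)) x)]
    (t : M → ℝ) (h : Fin n → ℝ → ℝ) : Prop where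
  smooth : ∀ i, ContDiffOn ℝ ∞ (h i) (range t)
  chart : ∀ p : M, ∃ φ ∈ IsManifold.maximalAtlas (𝓡 (n + 1)) ∞ M, p ∈ φ.source ∧
    ∀ y ∈ φ.target, t (φ.symm y) = y 0 ∧
      metricCoeff φ y
        = Matrix.diagonal (Fin.cons (1 : ℝ) (fun i : Fin n => h i (y 0) ^ 2) : Fin (n + 1) → ℝ)

/-- `(u₀, u₁, …, uₙ)` solves, on the set `J`, the system
`uⱼ' = (u₀ - A) uⱼ`, `u₀' = B + (u₀ - A) A`, where `A = ∑ᵢ uᵢ` and `B = ∑ᵢ uᵢ²`. -/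
def SolvesSteadySystem {n : ℕ} (J : Set ℝ) (u₀ : ℝ → ℝ) (u : Fin n → ℝ → ℝ) : Prop :=
  ∀ s ∈ J,
    (∀ j, HasDerivAt (u j) ((u₀ s - ∑ i, u i s) * u j s) s) ∧
    HasDerivAt u₀ ((∑ i, u i s ^ 2) + (u₀ s - ∑ i, u i s) * ∑ i, u i s) s

end

/-!
Put `u₀ = f'`, `uᵢ = hᵢ' / hᵢ`, `A = ∑ᵢ uᵢ`, `B = ∑ᵢ uᵢ²`. In a chart adapted to
`g = dt² + ∑ᵢ hᵢ(t)² dxᵢ²` the Christoffel symbols depend on `t` only, and the components of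
`Ric + Hess f = 0` along `∂ₜ` and `∂ᵢ` are the steady system
(`HasEuclideanLevels.solvesSteadySystem`).

The system linearizes. For `v = u₀ - A` one finds `v' = B` and `B' = 2 v B`, so `c = B - v²` is
constant. Let `q` be the global solution of `q'' = -c q` with `q(s₀) = 1`, `q'(s₀) = -v(s₀)`. Then
`v q + q'` solves the linear equation `w' = v w` and vanishes at `s₀`, so `v = -q' / q`,
`uⱼ = uⱼ(s₀) / q` and `u₀ = (A(s₀) - q') / q` (`SolvesSteadySystem.exists_linearization`), while
`q'² + c q² = B(s₀)` is conserved. As some `hᵢ` is not constant, `s₀` can be chosen with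
`B(s₀) > 0`, and then `q` has a real zero whatever the sign of `c`. The formulas extend the solution
to the component `J` of `{q ≠ 0}` containing `s₀`. At an endpoint `T` of `J` one has `q(T) = 0` and
`q'(T)² = B(s₀) ≠ 0`, hence `B = B(s₀) / q²` and `|v| = |q' / q|` tend to infinity; the numerator
of `u₀` vanishes at `T` only if `A(s₀)² = B(s₀)`, that is, if `A² = B` on `J`
(`SolvesSteadySystem.exists_blowup`).

For incompleteness, every point can be moved along its `t`-line by a distance at most the change of
`t`, upwards or downwards. On a complete manifold Caristi's principle
(`not_bddAbove_range_of_edist_le`) makes `t` unbounded in both directions, so its range is the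
whole line (`HasEuclideanLevels.range_eq_univ`). This contradicts `q ≠ 0` on the range of `t`.
-/

/-! ### Curvature of the diagonal metrics `∑ₖ wₖ(y₀) dyₖ²` -/

lemma partialD_of_eventuallyEq_comp {n : ℕ} (i : Fin (n + 1))
    {F : EuclideanSpace ℝ (Fin (n + 1)) → ℝ} {φ : ℝ → ℝ} {φ' : ℝ}
    {y : EuclideanSpace ℝ (Fin (n + 1))} (hF : F =ᶠ[𝓝 y] fun z => φ (z 0))
    (hφ : HasDerivAt φ φ' (y 0)) : partialD i F y = if i = 0 then φ' else 0 := by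
  have h1 := hφ.comp_hasFDerivAt y
    (EuclideanSpace.proj (𝕜 := ℝ) (0 : Fin (n + 1)) :
      EuclideanSpace ℝ (Fin (n + 1)) →L[ℝ] ℝ).hasFDerivAt
  have h2 : fderiv ℝ F y = _ := (h1.congr_of_eventuallyEq hF).fderiv
  rw [partialD, h2]
  simp [eq_comm]

/-- Coordinate data of a metric `∑ₖ wₖ(y₀) dyₖ²` with `w₀ = 1` on an open set `V`: the `wₖ` do not
vanish, and `Uₖ = wₖ' / (2 wₖ)` is differentiable with derivative `U'ₖ`. -/
structure IsDiagonalMetric {n : ℕ}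
    (G : EuclideanSpace ℝ (Fin (n + 1)) → Matrix (Fin (n + 1)) (Fin (n + 1)) ℝ)
    (V : Set (EuclideanSpace ℝ (Fin (n + 1)))) (w U U' : Fin (n + 1) → ℝ → ℝ) : Prop where
  isOpen : IsOpen V
  eq_diagonal : ∀ y ∈ V, G y = Matrix.diagonal fun k => w k (y 0)
  ne_zero : ∀ y ∈ V, ∀ k, w k (y 0) ≠ 0
  zero_eq_one : ∀ s, w 0 s = 1
  zero_eq_zero : ∀ s, U 0 s = 0
  hasDerivAt_weight : ∀ y ∈ V, ∀ k, HasDerivAt (w k) (2 * w k (y 0) * U k (y 0)) (y 0)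
  hasDerivAt_log : ∀ y ∈ V, ∀ k, HasDerivAt (U k) (U' k (y 0)) (y 0)

/-- The Christoffel symbols `Γᵏᵢⱼ` of `∑ₖ wₖ(y₀) dyₖ²` as functions of `s = y₀`, where
`wₖ' = 2 wₖ Uₖ`. -/
noncomputable def diagonalChristoffel {n : ℕ} (w U : Fin (n + 1) → ℝ → ℝ)
    (k i j : Fin (n + 1)) (s : ℝ) : ℝ :=
  (if i = 0 then if j = k then U k s else 0 else 0)
    + (if j = 0 then if i = k then U k s else 0 else 0)
    - (if k = 0 then if i = j then w i s * U i s else 0 else 0)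

namespace IsDiagonalMetric

variable {n : ℕ} {G : EuclideanSpace ℝ (Fin (n + 1)) → Matrix (Fin (n + 1)) (Fin (n + 1)) ℝ}
  {V : Set (EuclideanSpace ℝ (Fin (n + 1)))} {w U U' : Fin (n + 1) → ℝ → ℝ}
  {y : EuclideanSpace ℝ (Fin (n + 1))}

lemma partialD_coeff (H : IsDiagonalMetric G V w U U') (hy : y ∈ V) (i j l : Fin (n + 1)) :
    partialD i (fun z => G z j l) y
      = if i = 0 then if j = l then 2 * w j (y 0) * U j (y 0) else 0 else 0 := by
  refine partialD_of_eventuallyEq_comp i (φ := fun s => if j = l then w j s else 0) ?_ ?_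
  · filter_upwards [H.isOpen.mem_nhds hy] with z hz
    simp [H.eq_diagonal z hz, Matrix.diagonal_apply]
  · split_ifs
    · exact H.hasDerivAt_weight y hy j
    · exact hasDerivAt_const _ _

lemma christoffel_eq (H : IsDiagonalMetric G V w U U') (hy : y ∈ V) (k i j : Fin (n + 1)) :
    christoffel G k i j y = diagonalChristoffel w U k i j (y 0) := by
  have hinv : (G y)⁻¹ = Matrix.diagonal fun k => (w k (y 0))⁻¹ := by
    refine Matrix.inv_eq_right_inv ?_
    rw [H.eq_diagonal y hy, Matrix.diagonal_mul_diagonal, ← Matrix.diagonal_one]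
    congr 1
    funext k
    exact mul_inv_cancel₀ (H.ne_zero y hy k)
  simp only [christoffel, H.partialD_coeff hy, hinv, Matrix.diagonal_apply, ite_mul, zero_mul,
    Finset.sum_ite_eq, Finset.mem_univ, if_true, diagonalChristoffel]
  have hk := H.ne_zero y hy k
  have h0 := H.zero_eq_one (y 0)
  have hU0 := H.zero_eq_zero (y 0)
  split_ifs <;> subst_vars <;> simp_all <;> field_simp

/-- The derivative of `diagonalChristoffel`. -/
lemma hasDerivAt_diagonalChristoffel (H : IsDiagonalMetric G V w U U') (hy : y ∈ V)
    (k i j : Fin (n + 1)) :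
    HasDerivAt (diagonalChristoffel w U k i j)
      ((if i = 0 then if j = k then U' k (y 0) else 0 else 0)
        + (if j = 0 then if i = k then U' k (y 0) else 0 else 0)
        - (if k = 0 then if i = j then
            2 * w i (y 0) * U i (y 0) * U i (y 0) + w i (y 0) * U' i (y 0) else 0 else 0))
      (y 0) := by
  refine HasDerivAt.sub (HasDerivAt.add ?_ ?_) ?_
  · split_ifs
    exacts [H.hasDerivAt_log y hy k, hasDerivAt_const _ _, hasDerivAt_const _ _]
  · split_ifs
    exacts [H.hasDerivAt_log y hy k, hasDerivAt_const _ _, hasDerivAt_const _ _]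
  · split_ifs
    exacts [(H.hasDerivAt_weight y hy i).mul (H.hasDerivAt_log y hy i), hasDerivAt_const _ _,
      hasDerivAt_const _ _]

lemma partialD_christoffel (H : IsDiagonalMetric G V w U U') (hy : y ∈ V)
    (m k i j : Fin (n + 1)) :
    partialD m (christoffel G k i j) y = if m = 0 then
      ((if i = 0 then if j = k then U' k (y 0) else 0 else 0)
        + (if j = 0 then if i = k then U' k (y 0) else 0 else 0)
        - (if k = 0 then if i = j then
            2 * w i (y 0) * U i (y 0) * U i (y 0) + w i (y 0) * U' i (y 0) else 0 else 0))
      else 0 := by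
  refine partialD_of_eventuallyEq_comp m ?_ (H.hasDerivAt_diagonalChristoffel hy k i j)
  filter_upwards [H.isOpen.mem_nhds hy] with z hz using H.christoffel_eq hz k i j

lemma deriv_zero_eq_zero (H : IsDiagonalMetric G V w U U') (hy : y ∈ V) : U' 0 (y 0) = 0 := by
  have : U 0 = fun _ => 0 := funext H.zero_eq_zero
  have h := H.hasDerivAt_log y hy 0
  rw [this] at h
  exact h.unique (hasDerivAt_const _ _)

lemma ricciCoord_zero_zero (H : IsDiagonalMetric G V w U U') (hy : y ∈ V) :
    ricciCoord G 0 0 y = -∑ k, (U' k (y 0) + U k (y 0) ^ 2) := by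
  simp only [ricciCoord, H.partialD_christoffel hy, H.christoffel_eq hy, diagonalChristoffel]
  rw [← Finset.sum_neg_distrib]
  refine Finset.sum_congr rfl fun k _ => ?_
  have hU0 := H.zero_eq_zero (y 0)
  have hU0' := H.deriv_zero_eq_zero hy
  rcases eq_or_ne k 0 with rfl | hk
  · simp [hU0, hU0']
  · simp [hU0, hk, hk.symm]
    ring

lemma ricciCoord_self (H : IsDiagonalMetric G V w U U') (hy : y ∈ V) {a : Fin (n + 1)}
    (ha : a ≠ 0) :
    ricciCoord G a a y
      = -(w a (y 0) * U' a (y 0)) - (∑ k, U k (y 0)) * (w a (y 0) * U a (y 0)) := by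
  have hU0 := H.zero_eq_zero (y 0)
  have key : ∀ k l : Fin (n + 1),
      christoffel G k k l y * christoffel G l a a y
        - christoffel G k a l y * christoffel G l a k y
      = (if l = 0 then -(U k (y 0) * (w a (y 0) * U a (y 0))) else 0)
        + (if l = 0 then if k = a then U a (y 0) * (w a (y 0) * U a (y 0)) else 0 else 0)
        + (if l = a then if k = 0 then U a (y 0) * (w a (y 0) * U a (y 0)) else 0 else 0) := by
    intro k l
    simp only [H.christoffel_eq hy, diagonalChristoffel]
    by_cases hk : k = 0 <;> by_cases hl : l = 0 <;> by_cases hka : k = a <;>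
      by_cases hla : l = a <;> simp_all [eq_comm (a := a)]
    ring
  simp only [ricciCoord, key, H.partialD_christoffel hy]
  simp [Finset.sum_add_distrib, ha, Finset.sum_mul]
  ring

lemma hessCoord_zero_zero (H : IsDiagonalMetric G V w U U') (hy : y ∈ V)
    {F : EuclideanSpace ℝ (Fin (n + 1)) → ℝ} {f f' : ℝ → ℝ} {f'' : ℝ}
    (hF : ∀ z ∈ V, F z = f (z 0)) (hf : ∀ z ∈ V, HasDerivAt f (f' (z 0)) (z 0))
    (hf' : HasDerivAt f' f'' (y 0)) : hessCoord G F 0 0 y = f'' := by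
  have hD : ∀ z ∈ V, ∀ i, partialD i F z = if i = 0 then f' (z 0) else 0 := fun z hz i =>
    partialD_of_eventuallyEq_comp i
      (by filter_upwards [H.isOpen.mem_nhds hz] with x hx using hF x hx) (hf z hz)
  have hDD : partialD 0 (partialD 0 F) y = f'' := by
    rw [partialD_of_eventuallyEq_comp 0 _ hf', if_pos rfl]
    filter_upwards [H.isOpen.mem_nhds hy] with x hx
    rw [hD x hx, if_pos rfl]
  have hU0 := H.zero_eq_zero (y 0)
  simp [hessCoord, hDD, hD y hy, H.christoffel_eq hy, diagonalChristoffel, hU0]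

lemma hessCoord_self (H : IsDiagonalMetric G V w U U') (hy : y ∈ V) {a : Fin (n + 1)} (ha : a ≠ 0)
    {F : EuclideanSpace ℝ (Fin (n + 1)) → ℝ} {f f' : ℝ → ℝ}
    (hF : ∀ z ∈ V, F z = f (z 0)) (hf : ∀ z ∈ V, HasDerivAt f (f' (z 0)) (z 0)) :
    hessCoord G F a a y = w a (y 0) * U a (y 0) * f' (y 0) := by
  have hD : ∀ z ∈ V, ∀ i, partialD i F z = if i = 0 then f' (z 0) else 0 := fun z hz i =>
    partialD_of_eventuallyEq_comp i
      (by filter_upwards [H.isOpen.mem_nhds hz] with x hx using hF x hx) (hf z hz)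
  have hDD : partialD a (partialD a F) y = 0 := by
    rw [partialD_of_eventuallyEq_comp a (φ := fun _ => 0) _ (hasDerivAt_const _ _)]
    · simp
    filter_upwards [H.isOpen.mem_nhds hy] with x hx
    rw [hD x hx, if_neg ha]
  simp [hessCoord, hDD, hD y hy, H.christoffel_eq hy, diagonalChristoffel, ha]

end IsDiagonalMetric

/-! ### The steady system -/

/-- Uniqueness for the scalar linear equation `w' = v w`, by an integrating factor. -/
lemma eq_zero_of_hasDerivAt_mul {I : Set ℝ} (hIo : IsOpen I) (hIc : IsPreconnected I)
    {v w : ℝ → ℝ} (hv : ContinuousOn v I) (hw : ∀ s ∈ I, HasDerivAt w (v s * w s) s)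
    {s₀ : ℝ} (hs₀ : s₀ ∈ I) (h₀ : w s₀ = 0) : ∀ s ∈ I, w s = 0 := by
  have hV : ∀ s ∈ I, HasDerivAt (fun x => ∫ r in s₀..x, v r) (v s) s := by
    intro s hs
    have hsub : uIcc s₀ s ⊆ I := hIc.ordConnected.uIcc_subset hs₀ hs
    exact intervalIntegral.integral_hasDerivAt_right (hv.mono hsub).intervalIntegrable
      (hv.stronglyMeasurableAtFilter hIo s hs) (hv.continuousAt (hIo.mem_nhds hs))
  have hd : ∀ s ∈ I, HasDerivAt (fun x => w x * Real.exp (-∫ r in s₀..x, v r)) 0 s := by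
    intro s hs
    refine ((hw s hs).mul (hV s hs).neg.exp).congr_deriv ?_
    ring
  intro s hs
  have h := hIo.is_const_of_deriv_eq_zero hIc
    (fun x hx => (hd x hx).differentiableAt.differentiableWithinAt)
    (fun x hx => (hd x hx).deriv) hs hs₀
  simpa [h₀, Real.exp_ne_zero] using h

/-- The initial value problem `q'' = -c q`, `q(s₀) = 1`, `q'(s₀) = -v₀` has a global solution, and
this solution has a zero when its energy `q'² + c q² = v₀² + c` is positive. -/
lemma exists_oscillator_with_zero (c v₀ s₀ : ℝ) (hpos : 0 < v₀ ^ 2 + c) :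
    ∃ q q' : ℝ → ℝ, (∀ s, HasDerivAt q (q' s) s) ∧ (∀ s, HasDerivAt q' (-c * q s) s) ∧
      q s₀ = 1 ∧ q' s₀ = -v₀ ∧ ∃ s, q s = 0 := by
  suffices ∃ q q' : ℝ → ℝ, (∀ s, HasDerivAt q (q' s) s) ∧ (∀ s, HasDerivAt q' (-c * q s) s) ∧
      q 0 = 1 ∧ q' 0 = -v₀ ∧ ∃ s, q s = 0 by
    obtain ⟨q, q', h1, h2, h3, h4, z, hz⟩ := this
    refine ⟨fun s => q (s - s₀), fun s => q' (s - s₀), fun s => (h1 _).comp_sub_const s s₀,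
      fun s => (h2 _).comp_sub_const s s₀, by simpa using h3, by simpa using h4, z + s₀, by simpa⟩
  rcases lt_trichotomy c 0 with hc | rfl | hc
  · -- hyperbolic case: the zero is at `e^{2ks} = (v₀ + k) / (v₀ - k)`, where `|v₀| > k`
    obtain ⟨k, hk, rfl⟩ : ∃ k : ℝ, 0 < k ∧ c = -k ^ 2 :=
      ⟨√(-c), Real.sqrt_pos.2 (by linarith), by rw [Real.sq_sqrt (by linarith)]; ring⟩
    have he : ∀ s, HasDerivAt (fun s => Real.exp (k * s)) (k * Real.exp (k * s)) s := fun s => by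
      simpa [mul_comm] using ((hasDerivAt_id s).const_mul k).exp
    have he' : ∀ s, HasDerivAt (fun s => Real.exp (-(k * s))) (-k * Real.exp (-(k * s))) s :=
      fun s => by simpa [mul_comm] using ((hasDerivAt_id s).const_mul k).neg.exp
    have hne : v₀ - k ≠ 0 := fun h => by nlinarith
    have hr : 0 < (v₀ + k) / (v₀ - k) := by
      have : (v₀ + k) / (v₀ - k) = (v₀ ^ 2 + -k ^ 2) / (v₀ - k) ^ 2 := by
        field_simp
        ring
      rw [this]
      positivity
    refine ⟨fun s => (1 - v₀ / k) / 2 * Real.exp (k * s) + (1 + v₀ / k) / 2 * Real.exp (-(k * s)),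
      fun s => (1 - v₀ / k) / 2 * (k * Real.exp (k * s))
        + (1 + v₀ / k) / 2 * (-k * Real.exp (-(k * s))),
      fun s => ((he s).const_mul _).add ((he' s).const_mul _),
      fun s => ((((he s).const_mul k).const_mul _).add
        (((he' s).const_mul (-k)).const_mul _)).congr_deriv (by ring),
      by simp; ring, by simp; field_simp; ring, Real.log ((v₀ + k) / (v₀ - k)) / (2 * k), ?_⟩
    have hx : Real.exp (k * (Real.log ((v₀ + k) / (v₀ - k)) / (2 * k))) ^ 2
        = (v₀ + k) / (v₀ - k) := by
      rw [← Real.exp_nat_mul]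
      convert Real.exp_log hr using 2
      push_cast
      field_simp
    simp only [Real.exp_neg]
    set x := Real.exp (k * (Real.log ((v₀ + k) / (v₀ - k)) / (2 * k)))
    have hx0 : x ≠ 0 := Real.exp_ne_zero _
    rw [eq_div_iff hne] at hx
    field_simp
    linear_combination (-1 : ℝ) * hx
  · have hv : v₀ ≠ 0 := fun h => by simp [h] at hpos
    refine ⟨fun s => 1 - v₀ * s, fun _ => -v₀, fun s => ?_, fun s => ?_, by simp, rfl, v₀⁻¹,
      by simp [hv]⟩
    · simpa using ((hasDerivAt_id s).const_mul v₀).const_sub 1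
    · simpa using hasDerivAt_const s (-v₀)
  · -- trigonometric case: the zero is where `cot (k s) = v₀ / k`
    obtain ⟨k, hk, rfl⟩ : ∃ k : ℝ, 0 < k ∧ c = k ^ 2 :=
      ⟨√c, Real.sqrt_pos.2 hc, (Real.sq_sqrt hc.le).symm⟩
    have hcos : ∀ s, HasDerivAt (fun s => Real.cos (k * s)) (-k * Real.sin (k * s)) s := fun s => by
      simpa [mul_comm] using ((hasDerivAt_id s).const_mul k).cos
    have hsin : ∀ s, HasDerivAt (fun s => Real.sin (k * s)) (k * Real.cos (k * s)) s := fun s => by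
      simpa [mul_comm] using ((hasDerivAt_id s).const_mul k).sin
    refine ⟨fun s => Real.cos (k * s) - v₀ / k * Real.sin (k * s),
      fun s => -k * Real.sin (k * s) - v₀ / k * (k * Real.cos (k * s)),
      fun s => (hcos s).sub ((hsin s).const_mul _),
      fun s => (((hsin s).const_mul _).sub (((hcos s).const_mul k).const_mul _)).congr_deriv
        (by ring),
      by simp, by simp; field_simp, (Real.pi / 2 - Real.arctan (v₀ / k)) / k, ?_⟩
    have : k * ((Real.pi / 2 - Real.arctan (v₀ / k)) / k)
      = Real.pi / 2 - Real.arctan (v₀ / k) := by field_simp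
    simp only [this, Real.cos_pi_div_two_sub, Real.sin_pi_div_two_sub, Real.sin_arctan,
      Real.cos_arctan]
    ring

lemma tendsto_abs_div_atTop_of_zero {g q : ℝ → ℝ} {J : Set ℝ} {T : ℝ} (hg : ContinuousAt g T)
    (hgT : g T ≠ 0) (hq : ContinuousAt q T) (hqT : q T = 0) (hJ : ∀ s ∈ J, q s ≠ 0) :
    Tendsto (fun s => |g s / q s|) (𝓝[J] T) atTop := by
  have h1 : Tendsto q (𝓝[J] T) (𝓝[≠] 0) := by
    refine tendsto_nhdsWithin_iff.2 ⟨hqT ▸ hq.mono_left nhdsWithin_le_nhds, ?_⟩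
    filter_upwards [self_mem_nhdsWithin] with s hs using hJ s hs
  have h2 : Tendsto (fun s => |(q s)⁻¹|) (𝓝[J] T) atTop :=
    tendsto_norm_inv_nhdsNE_zero_atTop.comp h1
  have h3 : Tendsto (fun s => |g s|) (𝓝[J] T) (𝓝 |g T|) :=
    hg.abs.mono_left nhdsWithin_le_nhds
  simpa only [div_eq_mul_inv, abs_mul] using h3.pos_mul_atTop (abs_pos.2 hgT) h2

/-- If `q` has a zero, then the connected component of `s₀` in `{q ≠ 0}` is an open interval with a
finite endpoint, and `q` vanishes there. -/
lemma exists_endpoint_of_zero {q : ℝ → ℝ} (hq : Continuous q) {s₀ z : ℝ} (h₀ : q s₀ ≠ 0)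
    (hz : q z = 0) :
    ∃ J : Set ℝ, ∃ T : ℝ, IsOpen J ∧ J.OrdConnected ∧ T ∉ J ∧ T ∈ closure J ∧ q T = 0 ∧
      (∀ s ∈ J, q s ≠ 0) ∧
      ∀ I : Set ℝ, IsPreconnected I → s₀ ∈ I → (∀ s ∈ I, q s ≠ 0) → I ⊆ J := by
  set N : Set ℝ := {s | q s ≠ 0}
  have hN : IsOpen N := isOpen_ne_fun hq continuous_const
  set J := connectedComponentIn N s₀
  have hJo : IsOpen J := hN.connectedComponentIn
  have hJN : J ⊆ N := connectedComponentIn_subset _ _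
  have hJc : IsPreconnected J := isPreconnected_connectedComponentIn
  have h₀J : s₀ ∈ J := mem_connectedComponentIn h₀
  have hmax : ∀ I : Set ℝ, IsPreconnected I → s₀ ∈ I → (∀ s ∈ I, q s ≠ 0) → I ⊆ J :=
    fun I hI h₀I hIN => hI.subset_connectedComponentIn h₀I hIN
  have hfr : (frontier J).Nonempty := by
    rw [nonempty_frontier_iff]
    exact ⟨⟨s₀, h₀J⟩, fun h => hJN (h ▸ mem_univ z) hz⟩
  obtain ⟨T, hT⟩ := hfr
  rw [hJo.frontier_eq] at hT
  refine ⟨J, T, hJo, hJc.ordConnected, hT.2, hT.1, ?_, fun s hs => hJN hs, hmax⟩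
  -- otherwise `J ∪ {T}` would be a larger connected subset of `{q ≠ 0}`
  by_contra hqT
  refine hT.2 (hmax (insert T J) ?_ (mem_insert_of_mem _ h₀J) ?_ (mem_insert T J))
  · exact hJc.subset_closure (subset_insert T J) (insert_subset hT.1 subset_closure)
  · rintro s (rfl | hs)
    exacts [hqT, hJN hs]

/-- Linearization of the steady system. With `v = u₀ - A` one has `v' = B` and `B' = 2 v B`, so
`c = B - v²` is constant; hence `v = -q' / q` and `uⱼ = uⱼ(s₀) / q` for the solution of
`q'' = -c q` with `q(s₀) = 1`, `q'(s₀) = -v(s₀)`. -/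
theorem SolvesSteadySystem.exists_linearization {n : ℕ} {I : Set ℝ} (hIo : IsOpen I)
    (hIc : IsPreconnected I) {u₀ : ℝ → ℝ} {u : Fin n → ℝ → ℝ} (hu : SolvesSteadySystem I u₀ u)
    {s₀ : ℝ} (hs₀ : s₀ ∈ I) {i₀ : Fin n} (hi₀ : u i₀ s₀ ≠ 0) :
    ∃ (q q' : ℝ → ℝ) (c : ℝ), (∀ s, HasDerivAt q (q' s) s) ∧ (∀ s, HasDerivAt q' (-c * q s) s) ∧
      (∀ s, q' s ^ 2 + c * q s ^ 2 = ∑ i, u i s₀ ^ 2) ∧ (∃ z, q z = 0) ∧ (∀ s ∈ I, q s ≠ 0) ∧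
      (∀ s ∈ I, ∀ j, u j s = u j s₀ / q s) ∧
      ∀ s ∈ I, u₀ s = ((∑ i, u i s₀) - q' s) / q s := by
  set v : ℝ → ℝ := fun s => u₀ s - ∑ i, u i s with hv
  have hvB : ∀ s ∈ I, HasDerivAt v (∑ i, u i s ^ 2) s := by
    intro s hs
    refine ((hu s hs).2.sub (HasDerivAt.fun_sum fun i _ => (hu s hs).1 i)).congr_deriv ?_
    rw [← Finset.mul_sum]
    ring
  have hBd : ∀ s ∈ I, HasDerivAt (fun s => ∑ i, u i s ^ 2) (2 * v s * ∑ i, u i s ^ 2) s := by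
    intro s hs
    refine (HasDerivAt.fun_sum fun i _ => ((hu s hs).1 i).pow 2).congr_deriv ?_
    rw [Finset.mul_sum]
    refine Finset.sum_congr rfl fun i _ => ?_
    simp only [hv]
    ring
  obtain ⟨c, hc⟩ : ∃ c, ∀ s ∈ I, (∑ i, u i s ^ 2) - v s ^ 2 = c := by
    have hd : ∀ s ∈ I, HasDerivAt (fun s => (∑ i, u i s ^ 2) - v s ^ 2) 0 s := fun s hs =>
      ((hBd s hs).sub ((hvB s hs).pow 2)).congr_deriv (by ring)
    exact hIo.exists_is_const_of_deriv_eq_zero hIc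
      (fun x hx => (hd x hx).differentiableAt.differentiableWithinAt) fun x hx => (hd x hx).deriv
  have hB₀ : 0 < ∑ i, u i s₀ ^ 2 :=
    Finset.sum_pos' (fun _ _ => sq_nonneg _) ⟨i₀, Finset.mem_univ _, by positivity⟩
  obtain ⟨q, q', hq, hq', hq₀, hq'₀, hz⟩ :=
    exists_oscillator_with_zero c (v s₀) s₀ (by linarith [hc s₀ hs₀])
  have henergy : ∀ s, q' s ^ 2 + c * q s ^ 2 = ∑ i, u i s₀ ^ 2 := by
    intro s
    have hd : ∀ s, HasDerivAt (fun s => q' s ^ 2 + c * q s ^ 2) 0 s := fun s =>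
      (((hq' s).pow 2).add (((hq s).pow 2).const_mul c)).congr_deriv (by ring)
    have h := is_const_of_deriv_eq_zero (fun s => (hd s).differentiableAt)
      (fun s => (hd s).deriv) s s₀
    simp only [hq₀, hq'₀] at h
    linarith [hc s₀ hs₀]
  -- `v q + q'` satisfies `w' = v w` and vanishes at `s₀`
  have hvq : ∀ s ∈ I, v s * q s + q' s = 0 := by
    refine eq_zero_of_hasDerivAt_mul hIo hIc (v := v)
      (fun s hs => (hvB s hs).continuousAt.continuousWithinAt) (fun s hs => ?_) hs₀
      (by rw [hq₀, hq'₀]; ring)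
    refine (((hvB s hs).mul (hq s)).add (hq' s)).congr_deriv ?_
    linear_combination q s * hc s hs
  have huq : ∀ s ∈ I, ∀ j, u j s * q s = u j s₀ := by
    intro s hs j
    have hd : ∀ s ∈ I, HasDerivAt (fun s => u j s * q s) 0 s := fun s hs =>
      (((hu s hs).1 j).mul (hq s)).congr_deriv (by
        linear_combination u j s * hvq s hs)
    have h := hIo.is_const_of_deriv_eq_zero hIc
      (fun x hx => (hd x hx).differentiableAt.differentiableWithinAt)
      (fun x hx => (hd x hx).deriv) hs hs₀
    simpa [hq₀] using h
  have hne : ∀ s ∈ I, q s ≠ 0 := fun s hs h => hi₀ (by rw [← huq s hs i₀, h, mul_zero])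
  refine ⟨q, q', c, hq, hq', henergy, hz, hne, fun s hs j => ?_, fun s hs => ?_⟩
  · rw [eq_div_iff (hne s hs), huq s hs]
  · rw [eq_div_iff (hne s hs), ← Finset.sum_congr rfl fun i _ => huq s hs i, ← Finset.sum_mul]
    linear_combination hvq s hs

/-- A solution of the steady system on an open interval `I` with some `uᵢ ≠ 0` is not defined on
the whole line, and extends up to a finite endpoint where it blows up. -/
theorem SolvesSteadySystem.exists_blowup {n : ℕ} {I : Set ℝ} (hIo : IsOpen I)
    (hIc : IsPreconnected I) {u₀ : ℝ → ℝ} {u : Fin n → ℝ → ℝ} (hu : SolvesSteadySystem I u₀ u)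
    {s₀ : ℝ} (hs₀ : s₀ ∈ I) {i₀ : Fin n} (hi₀ : u i₀ s₀ ≠ 0) :
    I ≠ univ ∧ ∃ (J : Set ℝ) (T : ℝ) (U₀ : ℝ → ℝ) (U : Fin n → ℝ → ℝ),
      IsOpen J ∧ J.OrdConnected ∧ I ⊆ J ∧ T ∉ J ∧ T ∈ closure J ∧
      EqOn U₀ u₀ I ∧ (∀ i, EqOn (U i) (u i) I) ∧ SolvesSteadySystem J U₀ U ∧
      Tendsto (fun s => ∑ i, U i s ^ 2) (𝓝[J] T) atTop ∧
      Tendsto (fun s => |U₀ s - ∑ i, U i s|) (𝓝[J] T) atTop ∧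
      ((∃ s ∈ J, (∑ i, U i s) ^ 2 ≠ ∑ i, U i s ^ 2) →
        Tendsto (fun s => |U₀ s|) (𝓝[J] T) atTop) := by
  obtain ⟨q, q', c, hq, hq', hE, ⟨z, hz⟩, hne, huj, hu0⟩ :=
    hu.exists_linearization hIo hIc hs₀ hi₀
  have hqc : Continuous q := continuous_iff_continuousAt.2 fun s => (hq s).continuousAt
  obtain ⟨J, T, hJo, hJc, hTJ, hTc, hqT, hJne, hmax⟩ :=
    exists_endpoint_of_zero hqc (hne s₀ hs₀) hz
  have hB₀ : 0 < ∑ i, u i s₀ ^ 2 :=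
    Finset.sum_pos' (fun _ _ => sq_nonneg _) ⟨i₀, Finset.mem_univ _, by positivity⟩
  set A₀ := ∑ i, u i s₀ with hA₀
  set B₀ := ∑ i, u i s₀ ^ 2 with hB₀'
  have hq'T : q' T ^ 2 = B₀ := by simpa [hqT] using hE T
  have hA : ∀ s, ∑ i, u i s₀ / q s = A₀ / q s := fun s => by rw [hA₀, Finset.sum_div]
  have hB : ∀ s, ∑ i, (u i s₀ / q s) ^ 2 = B₀ / q s ^ 2 := fun s => by
    simp only [hB₀', Finset.sum_div, div_pow]
  have hv : ∀ s, (A₀ - q' s) / q s - A₀ / q s = -q' s / q s := fun s => by ring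
  refine ⟨fun h => hne z (h ▸ mem_univ z) hz, J, T, fun s => (A₀ - q' s) / q s,
    fun i s => u i s₀ / q s, hJo, hJc, hmax I hIc hs₀ hne, hTJ, hTc, fun s hs => (hu0 s hs).symm,
    fun i s hs => (huj s hs i).symm, ?_, ?_, ?_, ?_⟩
  · intro s hs
    have hqs := hJne s hs
    simp only [hA, hB, hv]
    refine ⟨fun j => ((hasDerivAt_const s (u j s₀)).div (hq s) hqs).congr_deriv ?_,
      (((hq' s).const_sub A₀).div (hq s) hqs).congr_deriv ?_⟩
    · field_simp
      ring
    · rw [← hE s]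
      field_simp
      ring
  · simp only [hB]
    have h := tendsto_abs_div_atTop_of_zero (g := fun _ => B₀) (q := fun s => q s ^ 2) (J := J)
      (T := T) continuousAt_const hB₀.ne' (hqc.pow 2).continuousAt (by simp [hqT])
      (fun s hs => pow_ne_zero 2 (hJne s hs))
    exact h.congr fun s => abs_of_nonneg (by positivity)
  · simp only [hA, hv]
    refine tendsto_abs_div_atTop_of_zero (g := fun s => -q' s) (hq' T).continuousAt.neg ?_
      hqc.continuousAt hqT hJne
    intro h
    rw [neg_eq_zero] at h
    rw [h] at hq'T
    exact hB₀.ne (by simpa using hq'T)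
  · rintro ⟨s, hs, hAB⟩
    simp only [hA, hB] at hAB
    refine tendsto_abs_div_atTop_of_zero (g := fun s => A₀ - q' s)
      (continuousAt_const.sub (hq' T).continuousAt) ?_ hqc.continuousAt hqT hJne
    intro h
    exact hAB (by rw [div_pow, sub_eq_zero.1 h, hq'T])

/-! ### Completeness and unboundedness of `t` -/

/-- A form of Caristi's principle: in a complete space, a continuous function which near every
point increases at least as much as the distance moved is unbounded above. -/
theorem not_bddAbove_range_of_edist_le {X : Type*} [EMetricSpace X] [CompleteSpace X] [Nonempty X]
    {t : X → ℝ} (ht : Continuous t)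
    (hstep : ∀ p, ∃ r, t p < t r ∧ edist p r ≤ ENNReal.ofReal (t r - t p)) :
    ¬ BddAbove (range t) := by
  intro hb
  let R : X → X → Prop := fun p r => t p ≤ t r ∧ edist p r ≤ ENNReal.ofReal (t r - t p)
  have hR : ∀ p r x, R p r → R r x → R p x := by
    rintro p r x ⟨h1, h2⟩ ⟨h3, h4⟩
    refine ⟨h1.trans h3, (edist_triangle p r x).trans ((add_le_add h2 h4).trans ?_)⟩
    rw [← ENNReal.ofReal_add (by linarith) (by linarith)]
    exact ENNReal.ofReal_le_ofReal (by linarith)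
  have hRrefl : ∀ p, R p p := fun p => ⟨le_rfl, by simp⟩
  -- each step achieves at least half of the gain available in the order `R`
  have hchoose : ∀ p, ∃ r, R p r ∧ ∀ x, R p x → t x ≤ 2 * t r - t p := by
    intro p
    have hbp : BddAbove (t '' {x | R p x}) := hb.mono (image_subset_range _ _)
    have hp : t p ≤ sSup (t '' {x | R p x}) := le_csSup hbp ⟨p, hRrefl p, rfl⟩
    rcases hp.eq_or_lt with h | h
    · exact ⟨p, hRrefl p, fun x hx => by linarith [le_csSup hbp ⟨x, hx, rfl⟩]⟩
    · obtain ⟨_, ⟨r, hr, rfl⟩, hlt⟩ := exists_lt_of_lt_csSup (s := t '' {x | R p x})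
        ⟨t p, p, hRrefl p, rfl⟩ (show (t p + sSup (t '' {x | R p x})) / 2 < _ by linarith)
      exact ⟨r, hr, fun x hx => by linarith [le_csSup hbp ⟨x, hx, rfl⟩]⟩
  choose next hnext hgain using hchoose
  let s : ℕ → X := fun k => next^[k] (Classical.arbitrary X)
  have hs : ∀ k, s (k + 1) = next (s k) := fun k => Function.iterate_succ_apply' _ _ _
  have hmono : ∀ k m, k ≤ m → R (s k) (s m) := by
    intro k m hkm
    induction m, hkm using Nat.le_induction with
    | base => exact hRrefl _
    | succ m _ ih => exact hR _ _ _ ih (hs m ▸ hnext (s m))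
  have htmono : Monotone (t ∘ s) := fun k m hkm => (hmono k m hkm).1
  have hlim := tendsto_atTop_ciSup htmono
    (hb.mono (by rw [range_comp]; exact image_subset_range _ _))
  set L := ⨆ k, (t ∘ s) k
  have hle : ∀ k, t (s k) ≤ L := htmono.ge_of_tendsto hlim
  have hcauchy : CauchySeq s := by
    refine EMetric.cauchySeq_iff_le_tendsto_0.2
      ⟨fun N => ENNReal.ofReal (L - t (s N)) + ENNReal.ofReal (L - t (s N)), ?_, ?_⟩
    · have hbound : ∀ N k, N ≤ k → edist (s N) (s k) ≤ ENNReal.ofReal (L - t (s N)) :=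
        fun N k hk => (hmono N k hk).2.trans (ENNReal.ofReal_le_ofReal (by linarith [hle k]))
      intro k m N hk hm
      refine (edist_triangle_left (s k) (s m) (s N)).trans ?_
      exact add_le_add (hbound N k hk) (hbound N m hm)
    · have : Tendsto (fun N => ENNReal.ofReal (L - t (s N))) atTop (𝓝 0) := by
        have h := ENNReal.tendsto_ofReal (hlim.const_sub L)
        simpa using h
      simpa using this.add this
  obtain ⟨p, hp⟩ := cauchySeq_tendsto_of_complete hcauchy
  have htp : t p = L := tendsto_nhds_unique ((ht.tendsto p).comp hp) hlim
  obtain ⟨r, hlt, hr⟩ := hstep p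
  have hsp : ∀ k, R (s k) p := by
    intro k
    refine ⟨htp ▸ hle k, ?_⟩
    refine le_of_tendsto (tendsto_const_nhds.edist hp) ?_
    filter_upwards [eventually_ge_atTop k] with m hm
    exact (hmono k m hm).2.trans (ENNReal.ofReal_le_ofReal (by linarith [hle m]))
  have hrk : ∀ k, t r ≤ 2 * t (s (k + 1)) - t (s k) := fun k => by
    rw [hs]
    exact hgain _ _ (hR _ _ _ (hsp k) ⟨hlt.le, hr⟩)
  have h2 : Tendsto (fun k => 2 * t (s (k + 1)) - t (s k)) atTop (𝓝 (2 * L - L)) :=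
    (((tendsto_add_atTop_iff_nat 1).2 hlim).const_mul 2).sub hlim
  have := ge_of_tendsto' h2 hrk
  linarith

/-! ### The coordinate `t` of a metric `dt² + ∑ᵢ hᵢ(t)² dxᵢ²` -/

section Manifold

variable {n : ℕ} {M : Type*} [EMetricSpace M]
  [ChartedSpace (EuclideanSpace ℝ (Fin (n + 1))) M]
  [RiemannianBundle (fun x : M => TangentSpace (𝓡 (n + 1)) x)]

lemma metricCoeff_self_pos [IsManifold (𝓡 (n + 1)) ∞ M]
    {φ : OpenPartialHomeomorph M (EuclideanSpace ℝ (Fin (n + 1)))}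
    (hφ : φ ∈ IsManifold.maximalAtlas (𝓡 (n + 1)) ∞ M) {y : EuclideanSpace ℝ (Fin (n + 1))}
    (hy : y ∈ φ.target) (i : Fin (n + 1)) : 0 < metricCoeff φ y i i := by
  have hd : φ.MDifferentiable (𝓡 (n + 1)) (𝓡 (n + 1)) :=
    ⟨(contMDiffOn_of_mem_maximalAtlas hφ).mdifferentiableOn (by simp),
      (contMDiffOn_symm_of_mem_maximalAtlas hφ).mdifferentiableOn (by simp)⟩
  have hinj := hd.symm.mfderiv_injective (x := y) hy
  set v := mfderiv (𝓡 (n + 1)) (𝓡 (n + 1)) φ.symm y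
    (EuclideanSpace.single i 1 : EuclideanSpace ℝ (Fin (n + 1))) with hv
  have hmv : metricCoeff φ y i i = inner ℝ v v := rfl
  rw [hmv]
  refine real_inner_self_pos.2 fun h0 => ?_
  have h1 : (EuclideanSpace.single i 1 : EuclideanSpace ℝ (Fin (n + 1))) = 0 :=
    hinj (h0.trans (map_zero _).symm)
  simpa using congrArg (fun x : EuclideanSpace ℝ (Fin (n + 1)) => x i) h1

namespace HasEuclideanLevels

variable {t : M → ℝ} {h : Fin n → ℝ → ℝ}

lemma continuous (H : HasEuclideanLevels t h) : Continuous t := by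
  refine continuous_iff_continuousAt.2 fun p => ?_
  obtain ⟨φ, -, hp, hφ⟩ := H.chart p
  have h1 : ContinuousAt (fun x => φ x 0) p :=
    (EuclideanSpace.proj (𝕜 := ℝ) (0 : Fin (n + 1))).continuous.continuousAt.comp
      (φ.continuousAt hp)
  refine h1.congr ?_
  filter_upwards [φ.open_source.mem_nhds hp] with x hx
  rw [← (hφ (φ x) (φ.map_source hx)).1, φ.left_inv hx]

/-- In an adapted chart the first coordinate line through `p` is parametrized by the change of `t`,
and its velocity `∂₀` has length one. -/
lemma exists_coordinate_line (H : HasEuclideanLevels t h) (p : M) :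
    ∃ φ ∈ IsManifold.maximalAtlas (𝓡 (n + 1)) ∞ M, p ∈ φ.source ∧ ∃ ε > 0, ∀ s ∈ Icc (-ε) ε,
      φ p + s • EuclideanSpace.single 0 1 ∈ φ.target ∧
        t (φ.symm (φ p + s • EuclideanSpace.single 0 1)) = t p + s ∧
        metricCoeff φ (φ p + s • EuclideanSpace.single 0 1) 0 0 = 1 := by
  obtain ⟨φ, hφm, hp, hφ⟩ := H.chart p
  refine ⟨φ, hφm, hp, ?_⟩
  have hc : ContinuousAt (fun s : ℝ =>
      φ p + s • (EuclideanSpace.single 0 1 : EuclideanSpace ℝ (Fin (n + 1)))) 0 := by fun_prop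
  have hnhds : φ.target ∈ 𝓝 (φ p + (0 : ℝ) •
      (EuclideanSpace.single 0 1 : EuclideanSpace ℝ (Fin (n + 1)))) := by
    simpa using φ.open_target.mem_nhds (φ.map_source hp)
  obtain ⟨ε, hε, hball⟩ := Metric.mem_nhds_iff.1 (hc.preimage_mem_nhds hnhds)
  refine ⟨ε / 2, by positivity, fun s hs => ?_⟩
  have hmem : φ p + s • EuclideanSpace.single 0 1 ∈ φ.target := hball (by
    rw [mem_ball_zero_iff, Real.norm_eq_abs, abs_lt]
    constructor <;> linarith [hs.1, hs.2])
  have htp : t p = φ p 0 := by rw [← (hφ _ (φ.map_source hp)).1, φ.left_inv hp]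
  refine ⟨hmem, ?_, ?_⟩
  · rw [(hφ _ hmem).1, htp]
    simp
  · rw [(hφ _ hmem).2]
    simp

lemma isOpen_range (H : HasEuclideanLevels t h) : IsOpen (range t) := by
  rw [isOpen_iff_mem_nhds]
  rintro _ ⟨p, rfl⟩
  obtain ⟨φ, -, -, ε, hε, hs⟩ := H.exists_coordinate_line p
  filter_upwards [Icc_mem_nhds (sub_lt_self (t p) hε) (lt_add_of_pos_right (t p) hε)] with r hr
  refine ⟨_, (hs (r - t p) ⟨by linarith [hr.1], by linarith [hr.2]⟩).2.1.trans (by ring)⟩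

/-- The coordinate lines of `t` have unit speed, so `t` can be changed by `±ε` over a distance at
most `ε`. -/
lemma exists_edist_le [IsManifold (𝓡 (n + 1)) ∞ M] [IsRiemannianManifold (𝓡 (n + 1)) M]
    (H : HasEuclideanLevels t h) (p : M) :
    ∃ ε > 0, ∀ σ : ℝ, |σ| = 1 → ∃ r, t r = t p + σ * ε ∧ edist p r ≤ ENNReal.ofReal ε := by
  obtain ⟨φ, hφm, hp, ε, hε, hs⟩ := H.exists_coordinate_line p
  refine ⟨ε, hε, fun σ hσ => ?_⟩
  have hσs : ∀ s ∈ Icc 0 ε, σ * s ∈ Icc (-ε) ε := fun s hs => by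
    rw [mem_Icc, ← abs_le, abs_mul, hσ, one_mul, abs_of_nonneg hs.1]
    exact hs.2
  set e : EuclideanSpace ℝ (Fin (n + 1)) := EuclideanSpace.single 0 1 with he
  set γ : ℝ → M := fun s => φ.symm (φ p + (σ * s) • e) with hγ
  have hℓ : ∀ s, HasFDerivAt (fun s : ℝ => φ p + (σ * s) • e)
      (ContinuousLinearMap.toSpanSingleton ℝ (σ • e)) s := fun s => by
    have h1 : HasDerivAt (fun s : ℝ => φ p + (σ * s) • e) (σ • e) s := by
      simpa using (((hasDerivAt_id s).const_mul σ).smul_const e).const_add (φ p)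
    exact h1.hasFDerivAt
  have hℓc : ContMDiff 𝓘(ℝ, ℝ) (𝓡 (n + 1)) 1 (fun s : ℝ => φ p + (σ * s) • e) := by
    rw [contMDiff_iff_contDiff]
    fun_prop
  have hsymm : ∀ s ∈ Icc 0 ε, ContMDiffAt (𝓡 (n + 1)) (𝓡 (n + 1)) ∞ φ.symm
      (φ p + (σ * s) • e) := fun s hs' =>
    contMDiffAt_symm_of_mem_maximalAtlas hφm (hs _ (hσs s hs')).1
  have hγc : ContMDiffOn 𝓘(ℝ, ℝ) (𝓡 (n + 1)) 1 γ (Icc 0 ε) := fun s hs' =>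
    (((hsymm s hs').of_le (by simp)).comp s hℓc.contMDiffAt).contMDiffWithinAt
  have hspeed : ∀ s ∈ Icc 0 ε, ‖mfderiv 𝓘(ℝ, ℝ) (𝓡 (n + 1)) γ s 1‖ₑ = 1 := by
    intro s hs'
    have h1 : HasMFDerivAt 𝓘(ℝ, ℝ) (𝓡 (n + 1)) γ s _ :=
      ((hsymm s hs').mdifferentiableAt (by simp)).hasMFDerivAt.comp s (hℓ s).hasMFDerivAt
    have h2 : mfderiv 𝓘(ℝ, ℝ) (𝓡 (n + 1)) γ s 1
        = σ • mfderiv (𝓡 (n + 1)) (𝓡 (n + 1)) φ.symm (φ p + (σ * s) • e) e := by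
      rw [h1.mfderiv]
      change mfderiv (𝓡 (n + 1)) (𝓡 (n + 1)) φ.symm (φ p + (σ * s) • e) ((1 : ℝ) • (σ • e)) = _
      rw [one_smul]
      exact map_smul _ σ e
    have h3 := (hs _ (hσs s hs')).2.2
    have h4 : inner ℝ (mfderiv (𝓡 (n + 1)) (𝓡 (n + 1)) φ.symm (φ p + (σ * s) • e) e)
      (mfderiv (𝓡 (n + 1)) (𝓡 (n + 1)) φ.symm (φ p + (σ * s) • e) e) = (1 : ℝ) := h3
    rw [h2, enorm_smul, ← ofReal_norm (E := TangentSpace (𝓡 (n + 1)) (γ s)),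
      norm_eq_sqrt_real_inner]
    erw [h4]
    simp [← ofReal_norm, hσ]
  refine ⟨γ ε, ?_, ?_⟩
  · exact (hs _ (hσs ε ⟨hε.le, le_rfl⟩)).2.1
  · have hγ0 : γ 0 = p := by simp [hγ, φ.left_inv hp]
    have h1 := Manifold.riemannianEDist_le_pathELength hγc hγ0 rfl hε.le
    rw [IsRiemannianManifold.out (I := 𝓡 (n + 1)) p (γ ε)]
    refine h1.trans ?_
    rw [Manifold.pathELength_eq_lintegral_mfderiv_Icc,
      MeasureTheory.setLIntegral_congr_fun measurableSet_Icc hspeed]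
    simp

end HasEuclideanLevels

end Manifold

/-! ### The soliton equation and the range of `t` -/

section Manifold

variable {n : ℕ} {M : Type*} [EMetricSpace M]
  [ChartedSpace (EuclideanSpace ℝ (Fin (n + 1))) M] [IsManifold (𝓡 (n + 1)) ∞ M]
  [RiemannianBundle (fun x : M => TangentSpace (𝓡 (n + 1)) x)]

namespace HasEuclideanLevels

variable {t : M → ℝ} {h : Fin n → ℝ → ℝ}

lemma ne_zero (H : HasEuclideanLevels t h) {s : ℝ} (hs : s ∈ range t) (i : Fin n) : h i s ≠ 0 := by
  obtain ⟨p, rfl⟩ := hs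
  obtain ⟨φ, hφm, hp, hφ⟩ := H.chart p
  have hy := φ.map_source hp
  have hpos := metricCoeff_self_pos hφm hy i.succ
  obtain ⟨ht, hG⟩ := hφ _ hy
  rw [φ.left_inv hp] at ht
  rw [hG, Matrix.diagonal_apply_eq, Fin.cons_succ, ← ht] at hpos
  exact fun h0 => by simp [h0] at hpos

lemma isDiagonalMetric (H : HasEuclideanLevels t h)
    {φ : OpenPartialHomeomorph M (EuclideanSpace ℝ (Fin (n + 1)))}
    (hφ : ∀ y ∈ φ.target, t (φ.symm y) = y 0 ∧ metricCoeff φ y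
      = Matrix.diagonal (Fin.cons (1 : ℝ) (fun i : Fin n => h i (y 0) ^ 2) : Fin (n + 1) → ℝ)) :
    IsDiagonalMetric (metricCoeff φ) φ.target
      (Fin.cons (fun _ => 1) fun i s => h i s ^ 2)
      (Fin.cons (fun _ => 0) fun i s => deriv (h i) s / h i s)
      (Fin.cons (fun _ => 0) fun i => deriv fun s => deriv (h i) s / h i s) := by
  have hrange : ∀ y ∈ φ.target, y 0 ∈ range t := fun y hy => ⟨_, (hφ y hy).1⟩
  have hh : ∀ y ∈ φ.target, ∀ i, ContDiffAt ℝ ∞ (h i) (y 0) := fun y hy i =>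
    (H.smooth i).contDiffAt (H.isOpen_range.mem_nhds (hrange y hy))
  refine ⟨φ.open_target, fun y hy => ?_, fun y hy => ?_, fun _ => rfl, fun _ => rfl,
    fun y hy => ?_, fun y hy => ?_⟩
  · rw [(hφ y hy).2]
    congr 1
    funext k
    cases k using Fin.cases <;> rfl
  · refine Fin.cases one_ne_zero fun i => ?_
    exact pow_ne_zero 2 (H.ne_zero (hrange y hy) i)
  · refine Fin.cases ?_ fun i => ?_
    · simpa using hasDerivAt_const (y 0) (1 : ℝ)
    · have h0 := H.ne_zero (hrange y hy) i
      refine (((hh y hy i).differentiableAt (by simp)).hasDerivAt.pow 2).congr_deriv ?_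
      simp only [Fin.cons_succ]
      field_simp
      ring
  · refine Fin.cases (hasDerivAt_const _ _) fun i => ?_
    simp only [Fin.cons_succ]
    refine DifferentiableAt.hasDerivAt ?_
    refine DifferentiableAt.div ?_ ((hh y hy i).differentiableAt (by simp))
      (H.ne_zero (hrange y hy) i)
    exact (((H.smooth i).deriv_of_isOpen H.isOpen_range (m := ∞) le_rfl).differentiableOn
      (by simp)).differentiableAt (H.isOpen_range.mem_nhds (hrange y hy))

/-- The components of `Ric + Hess f = 0` along `∂ₜ` and `∂ᵢ`. -/
theorem solvesSteadySystem (H : HasEuclideanLevels t h) {f : ℝ → ℝ}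
    (hf : ContDiffOn ℝ ∞ f (range t))
    (hsol : IsGradientRicciSoliton (M := M) (d := n + 1) 0 (f ∘ t)) :
    SolvesSteadySystem (range t) (deriv f) (fun i s => deriv (h i) s / h i s) := by
  rintro _ ⟨p, rfl⟩
  obtain ⟨φ, hφm, hp, hφ⟩ := H.chart p
  have hy := φ.map_source hp
  have hD := H.isDiagonalMetric hφ
  have htp : t p = φ p 0 := by rw [← (hφ _ hy).1, φ.left_inv hp]
  have hfc : ∀ z ∈ φ.target, ContDiffAt ℝ ∞ f (z 0) := fun z hz =>
    hf.contDiffAt (H.isOpen_range.mem_nhds ⟨_, (hφ z hz).1⟩)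
  have hF : ∀ z ∈ φ.target, ((f ∘ t) ∘ φ.symm) z = f (z 0) := fun z hz => by
    simp [(hφ z hz).1]
  have hf1 : ∀ z ∈ φ.target, HasDerivAt f (deriv f (z 0)) (z 0) := fun z hz =>
    ((hfc z hz).differentiableAt (by simp)).hasDerivAt
  have hf2 : HasDerivAt (deriv f) (deriv (deriv f) (φ p 0)) (φ p 0) :=
    (((hf.deriv_of_isOpen H.isOpen_range (m := ∞) le_rfl).differentiableOn
      (by simp)).differentiableAt (H.isOpen_range.mem_nhds ⟨_, (hφ _ hy).1⟩)).hasDerivAt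
  rw [htp]
  have hU : ∀ i, deriv (fun s => deriv (h i) s / h i s) (φ p 0)
      = (deriv f (φ p 0) - ∑ i, deriv (h i) (φ p 0) / h i (φ p 0))
        * (deriv (h i) (φ p 0) / h i (φ p 0)) := by
    intro i
    have hE := hsol.2 φ hφm _ hy i.succ i.succ
    rw [hD.ricciCoord_self hy i.succ_ne_zero, hD.hessCoord_self hy i.succ_ne_zero hF hf1,
      Fin.sum_univ_succ] at hE
    simp only [Fin.cons_zero, Fin.cons_succ, zero_add, zero_mul] at hE
    have h0 : h i (φ p 0) ^ 2 ≠ 0 := pow_ne_zero 2 (H.ne_zero (htp ▸ mem_range_self p) i)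
    apply mul_left_cancel₀ h0
    linear_combination -hE
  refine ⟨fun j => ?_, ?_⟩
  · rw [← hU j]
    exact hD.hasDerivAt_log _ hy j.succ
  · refine hf2.congr_deriv ?_
    have hE := hsol.2 φ hφm _ hy 0 0
    rw [hD.ricciCoord_zero_zero hy, hD.hessCoord_zero_zero hy hF hf1 hf2,
      Fin.sum_univ_succ] at hE
    simp only [Fin.cons_zero, Fin.cons_succ, zero_add, zero_mul, Finset.sum_add_distrib, hU,
      ← Finset.mul_sum] at hE
    linear_combination hE

/-- By Caristi's principle for `t` and for `-t`, on a complete manifold `t` is unbounded in both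
directions. -/
theorem range_eq_univ [ConnectedSpace M] [CompleteSpace M] [IsRiemannianManifold (𝓡 (n + 1)) M]
    (H : HasEuclideanLevels t h) : range t = univ := by
  have hup : ¬ BddAbove (range t) := by
    refine not_bddAbove_range_of_edist_le H.continuous fun p => ?_
    obtain ⟨ε, hε, hs⟩ := H.exists_edist_le p
    obtain ⟨r, hr, hd⟩ := hs 1 (by simp)
    exact ⟨r, by linarith, hd.trans (ENNReal.ofReal_le_ofReal (by linarith))⟩
  have hdown : ¬ BddAbove (range fun p => -t p) := by
    refine not_bddAbove_range_of_edist_le H.continuous.neg fun p => ?_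
    obtain ⟨ε, hε, hs⟩ := H.exists_edist_le p
    obtain ⟨r, hr, hd⟩ := hs (-1) (by simp)
    exact ⟨r, by linarith, hd.trans (ENNReal.ofReal_le_ofReal (by linarith))⟩
  refine eq_univ_of_forall fun s => ?_
  obtain ⟨_, ⟨a, rfl⟩, ha⟩ := not_bddAbove_iff.1 hup s
  obtain ⟨_, ⟨b, rfl⟩, hb⟩ := not_bddAbove_iff.1 hdown (-s)
  exact (isPreconnected_range H.continuous).ordConnected.out (mem_range_self b) (mem_range_self a)
    ⟨by linarith, ha.le⟩

end HasEuclideanLevels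

end Manifold

theorem proposition4p2 {n : ℕ} (hn : 2 ≤ n)
    {M : Type*} [EMetricSpace M] [ConnectedSpace M]
    [ChartedSpace (EuclideanSpace ℝ (Fin (n + 1))) M] [IsManifold (𝓡 (n + 1)) ∞ M]
    [RiemannianBundle (fun x : M => TangentSpace (𝓡 (n + 1)) x)]
    [IsContMDiffRiemannianBundle (𝓡 (n + 1)) ∞ (EuclideanSpace ℝ (Fin (n + 1)))
      (fun x : M => TangentSpace (𝓡 (n + 1)) x)]
    [IsRiemannianManifold (𝓡 (n + 1)) M]
    -- the metric is `dt² + ∑ hᵢ(t)² dxᵢ²`, and not every `hᵢ` is constant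
    (t : M → ℝ) (h : Fin n → ℝ → ℝ) (hform : HasEuclideanLevels t h)
    (hnonconst : ∃ i, ∃ s ∈ range t, ∃ s' ∈ range t, h i s ≠ h i s')
    -- the potential is the function `f = f(t)` of `t`, and the soliton is steady
    (f : ℝ → ℝ) (hf : ContDiffOn ℝ ∞ f (range t))
    (hsol : IsGradientRicciSoliton (M := M) (d := n + 1) 0 (f ∘ t)) :
    -- the metric is incomplete
    ¬ CompleteSpace M ∧
    -- `u₀ = f'` and `uᵢ = hᵢ' / hᵢ` solve the system of differential equations
    SolvesSteadySystem (range t) (deriv f) (fun i s => deriv (h i) s / h i s) ∧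
    -- the solution extends to an open interval `J` with a finite end `T` at which it blows up
    ∃ (J : Set ℝ) (T : ℝ) (u₀ : ℝ → ℝ) (u : Fin n → ℝ → ℝ),
      IsOpen J ∧ J.OrdConnected ∧ range t ⊆ J ∧ T ∉ J ∧ T ∈ closure J ∧
      EqOn u₀ (deriv f) (range t) ∧
      (∀ i, EqOn (u i) (fun s => deriv (h i) s / h i s) (range t)) ∧
      SolvesSteadySystem J u₀ u ∧
      Tendsto (fun s => ∑ i, u i s ^ 2) (𝓝[J] T) atTop ∧
      Tendsto (fun s => |u₀ s - ∑ i, u i s|) (𝓝[J] T) atTop ∧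
      -- and `u₀` itself blows up there, unless `A² = B` everywhere
      ((∃ s ∈ J, (∑ i, u i s) ^ 2 ≠ ∑ i, u i s ^ 2) →
        Tendsto (fun s => |u₀ s|) (𝓝[J] T) atTop) := by
  have hI := hform.isOpen_range
  have hIc : IsPreconnected (range t) := isPreconnected_range hform.continuous
  have hsys := hform.solvesSteadySystem hf hsol
  obtain ⟨i, s₀, hs₀, hi⟩ : ∃ i, ∃ s ∈ range t, deriv (h i) s / h i s ≠ 0 := by
    obtain ⟨i, s, hs, s', hs', hne⟩ := hnonconst
    by_contra! hzero
    refine hne (hI.is_const_of_deriv_eq_zero hIc ((hform.smooth i).differentiableOn (by simp))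
      (fun x hx => ?_) hs hs')
    simpa [hform.ne_zero hx i] using hzero i x hx
  obtain ⟨huniv, hblow⟩ := hsys.exists_blowup hI hIc hs₀ hi
  exact ⟨fun _ => huniv hform.range_eq_univ, hsys, hblow⟩
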